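/- Let $F$ be a field and $n\in\mathbb N$ with $n>1$. Let $\mathcal P=\mathbb P^n_F=(F^{n+1}\setminus\{0\})/F^\times$. For distinct $x=[\bar x],\,y=[\bar y]\in\mathcal P$ let $\ell(x,y)=\{[a\bar x+b\bar y] : a,b\in F^\times\}\cup\{x,y\}$ be the line through $x$ and $y$, and let $\mathcal L=\{\ell(x,y) : x,y\in\mathcal P,\ x\ne y\}$ be the set of lines. An incidence abelian group structure on $(\mathcal P,\mathcal L)$ is an abelian group operation $\cdot$ on the set $\mathcal P$ such that for every $a\in\mathcal P$ the maps $\alpha_a:\mathcal P\to\mathcal P$, $\alpha_a(x)=a\cdot x$, and $\beta_a:\mathcal L\to\mathcal L$, $\beta_a(\ell(x,y))=\ell(a\cdot x,a\cdot y)$ for $x\neq y$, form a collineation, that is, $\beta_a$ is well defined and both maps are bijections. If $F$ is algebraically closed or real closed, then $(\mathcal P,\mathcal L)$ does not admit an incidence abelian group structure. -/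

import Mathlib

namespace IncidenceGroup

variable (F : Type*) (V : Type*) [Field F] [AddCommGroup V] [Module F V]

variable {F V} in
/-- The line `ℓ(x, y)` through two points `x`, `y` of the projective space `ℙ(V)`: the two points
themselves, together with all points represented by a vector `a x̄ + b ȳ` with `a, b ∈ Fˣ`, where
`x̄` and `ȳ` are representatives of `x` and `y`. (It is only used as a line when `x ≠ y`.) -/
def line (x y : Projectivization F V) : Set (Projectivization F V) :=
  {z | ∃ a b : F, a ≠ 0 ∧ b ≠ 0 ∧ z.rep = a • x.rep + b • y.rep} ∪ {x, y}

/-- The set of lines of `ℙ(V)`: the sets `ℓ(x, y)` for distinct points `x`, `y`. Together with the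
set of points `Projectivization F V` this is the projective geometry realised as `ℙ(V)`. -/
def lines : Set (Set (Projectivization F V)) :=
  {l | ∃ x y : Projectivization F V, x ≠ y ∧ l = line x y}

variable {F V} in
/-- A collineation between the projective geometry realised as `ℙ(V)` and itself: a bijection `α`
of the points and a bijection `β` of the lines with `β (ℓ(x, y)) = ℓ(α x, α y)` for all `x ≠ y`. -/
structure IsCollineation (α : Projectivization F V → Projectivization F V)
    (β : lines F V → lines F V) : Prop where
  bijective_points : Function.Bijective α
  bijective_lines : Function.Bijective β
  map_line : ∀ (x y : Projectivization F V) (h : x ≠ y),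
    (β ⟨line x y, x, y, h, rfl⟩ : Set (Projectivization F V)) = line (α x) (α y)

/-- The projective geometry realised as `ℙ(V)` admits an incidence abelian group structure: its
set of points carries an abelian group structure for which every translation `x ↦ a * x`, together
with the induced map `ℓ(x, y) ↦ ℓ(a * x, a * y)` on lines, is a collineation. (The condition
`map_line` determines the map on lines.) -/
def AdmitsIncidenceAbelianGroup : Prop :=
  ∃ _ : CommGroup (Projectivization F V), ∀ a : Projectivization F V,
    ∃ β : lines F V → lines F V, IsCollineation (fun x => a * x) β

end IncidenceGroup

/-! By the fundamental theorem of projective geometry (`exists_semilinear`, which needs vector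
dimension at least three), each translation comes from a semilinear map `mul x`, scaled so that `mul
x e = x`, where `e` is `neutral`. Commutativity up to scalars then makes `mul (e + x) y` a
combination of `y` and `mul x y` with coefficients depending on `y`. Evaluating this at `e + t • y`
in two ways and comparing coefficients controls both the coefficients and the twists.

If `e`, `x`, `x * x` were not collinear, this comparison and Dedekind's independence of characters
would make `mul x` linear. Irreducible polynomials over `F` have degree at most two, so `mul x`
would have an invariant subspace of dimension at most two; commutativity carries this back to `x *
x` lying on the line through `e` and `x`, a contradiction. Hence every line through `e` is a
subgroup, and its cosets are disjoint. So for `y` off the line, `e`, `x`, `y`, `x * y` are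
independent, and a second comparison makes `mul x` linear for every nonscalar `x`, with `mul (e + x)
y = y + mul x y`; the product now commutes exactly.

Over an algebraically closed field an eigenvector of `mul x` forces `x` to be a multiple of `e`.
Over a real closed field, completing the square twice gives independent `a`, `b` whose squares are
nonsquare multiples of `e`. Suitable nonzero multiples of `a` and `b` have equal squares, and
factoring the difference of squares contradicts cancellation. -/

namespace IncidenceGroup

open Submodule

/-! ### The fundamental theorem of projective geometry -/

section Fundamental

variable {F V : Type*} [Field F] [AddCommGroup V] [Module F V]

variable (F) in
/-- Two vectors are proportional if they differ by a nonzero scalar factor. -/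
def Proportional (x y : V) : Prop := ∃ k : F, k ≠ 0 ∧ x = k • y

namespace Proportional

theorem refl (x : V) : Proportional F x x := ⟨1, one_ne_zero, (one_smul _ _).symm⟩

theorem symm {x y : V} (h : Proportional F x y) : Proportional F y x := by
  obtain ⟨k, hk, rfl⟩ := h
  exact ⟨k⁻¹, inv_ne_zero hk, by rw [smul_smul, inv_mul_cancel₀ hk, one_smul]⟩

theorem trans {x y z : V} (h : Proportional F x y) (h' : Proportional F y z) :
    Proportional F x z := by
  obtain ⟨k, hk, rfl⟩ := h
  obtain ⟨l, hl, rfl⟩ := h'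
  exact ⟨k * l, mul_ne_zero hk hl, smul_smul _ _ _⟩

theorem mem_iff {x y : V} (h : Proportional F x y) (W : Submodule F V) : x ∈ W ↔ y ∈ W := by
  obtain ⟨k, hk, rfl⟩ := h
  exact W.smul_mem_iff hk

theorem eq_zero_iff {x y : V} (h : Proportional F x y) : x = 0 ↔ y = 0 := by
  obtain ⟨k, hk, rfl⟩ := h
  simp [hk]

theorem smul_left {k : F} (hk : k ≠ 0) (x : V) : Proportional F (k • x) x := ⟨k, hk, rfl⟩

theorem of_eq_smul {x y : V} {k : F} (hx : x ≠ 0) (h : x = k • y) : Proportional F x y :=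
  ⟨k, by rintro rfl; exact hx (by simpa using h), h⟩

end Proportional

theorem mem_span_pair_left (u v : V) : u ∈ span F {u, v} := subset_span (by simp)

theorem mem_span_pair_right (u v : V) : v ∈ span F {u, v} := subset_span (by simp)

theorem span_pair_le {u v : V} {W : Submodule F V} (hu : u ∈ W) (hv : v ∈ W) :
    span F {u, v} ≤ W := by
  rw [span_le]
  rintro x (rfl | rfl) <;> assumption

variable (F) in
/-- Linear independence of two vectors in terms of coefficients. -/
def Indep₂ (u v : V) : Prop := ∀ a b : F, a • u + b • v = 0 → a = 0 ∧ b = 0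

variable (F) in
/-- Linear independence of three vectors in terms of coefficients. -/
def Indep₃ (u v w : V) : Prop :=
  ∀ a b c : F, a • u + b • v + c • w = 0 → a = 0 ∧ b = 0 ∧ c = 0

theorem Indep₂.symm {u v : V} (h : Indep₂ F u v) : Indep₂ F v u := fun a b hab =>
  (h b a (by rw [← hab]; abel)).symm

theorem Indep₂.ne_zero_left {u v : V} (h : Indep₂ F u v) : u ≠ 0 := by
  rintro rfl
  simpa using h 1 0 (by simp)

theorem Indep₂.ne_zero_right {u v : V} (h : Indep₂ F u v) : v ≠ 0 := h.symm.ne_zero_left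

theorem Indep₂.notMem {u v : V} (h : Indep₂ F u v) : v ∉ span F {u} := fun hv => by
  obtain ⟨a, rfl⟩ := mem_span_singleton.1 hv
  simpa using h a (-1) (by module)

theorem indep₂_of_notMem {u v : V} (hu : u ≠ 0) (hv : v ∉ span F {u}) : Indep₂ F u v := by
  intro a b hab
  have hb : b = 0 := by
    by_contra hb
    refine hv (mem_span_singleton.2 ⟨-b⁻¹ * a, ?_⟩)
    have : b • v = -(a • u) := by rw [eq_neg_iff_add_eq_zero, ← hab]; abel
    rw [mul_smul, neg_smul, ← smul_neg, ← this, smul_smul, inv_mul_cancel₀ hb, one_smul]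
  subst hb
  simpa [hu] using hab

theorem Indep₃.swap₁₂ {u v w : V} (h : Indep₃ F u v w) : Indep₃ F v u w := fun a b c habc => by
  obtain ⟨h₁, h₂, h₃⟩ := h b a c (by rw [← habc]; abel)
  exact ⟨h₂, h₁, h₃⟩

theorem Indep₃.swap₂₃ {u v w : V} (h : Indep₃ F u v w) : Indep₃ F u w v := fun a b c habc => by
  obtain ⟨h₁, h₂, h₃⟩ := h a c b (by rw [← habc]; abel)
  exact ⟨h₁, h₃, h₂⟩

theorem Indep₃.indep₂ {u v w : V} (h : Indep₃ F u v w) : Indep₂ F u v := fun a b hab => by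
  obtain ⟨h₁, h₂, -⟩ := h a b 0 (by simpa using hab)
  exact ⟨h₁, h₂⟩

theorem Indep₃.notMem {u v w : V} (h : Indep₃ F u v w) : w ∉ span F {u, v} := fun hw => by
  obtain ⟨a, b, rfl⟩ := mem_span_pair.1 hw
  simpa using (h a b (-1) (by module)).2.2

theorem indep₃_of_notMem {u v w : V} (huv : Indep₂ F u v) (hw : w ∉ span F {u, v}) :
    Indep₃ F u v w := by
  intro a b c habc
  have hc : c = 0 := by
    by_contra hc
    refine hw ((smul_mem_iff _ hc).1 ?_)
    have : c • w = (-a) • u + (-b) • v := by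
      rw [eq_comm, ← sub_eq_zero, ← neg_eq_zero, ← habc]; module
    rw [this]
    exact mem_span_pair.2 ⟨_, _, rfl⟩
  subst hc
  obtain ⟨h₁, h₂⟩ := huv a b (by simpa using habc)
  exact ⟨h₁, h₂, rfl⟩

/-- A map of vectors inducing an injective map of projective points which preserves and
reflects collinearity. -/
structure IsProjective (L : V → V) : Prop where
  eq_zero_iff : ∀ v, L v = 0 ↔ v = 0
  mem_span_iff : ∀ u v w, w ∈ span F {u, v} ↔ L w ∈ span F {L u, L v}

namespace IsProjective

variable {L : V → V}

theorem mem_span_iff_of_proportional (hL : IsProjective (F := F) L) {u v w u' v' w' : V}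
    (hu : Proportional F u' (L u)) (hv : Proportional F v' (L v)) (hw : Proportional F w' (L w)) :
    w ∈ span F {u, v} ↔ w' ∈ span F {u', v'} := by
  rw [hL.mem_span_iff, hw.mem_iff]
  have : span F {L u, L v} = span F {u', v'} := by
    refine le_antisymm (span_pair_le ?_ ?_) (span_pair_le ?_ ?_)
    · exact (hu.mem_iff _).1 (mem_span_pair_left _ _)
    · exact (hv.mem_iff _).1 (mem_span_pair_right _ _)
    · exact (hu.mem_iff _).2 (mem_span_pair_left _ _)
    · exact (hv.mem_iff _).2 (mem_span_pair_right _ _)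
  rw [this]

theorem indep₂ (hL : IsProjective (F := F) L) {u v u' v' : V} (huv : Indep₂ F u v)
    (hu : Proportional F u' (L u)) (hv : Proportional F v' (L v)) : Indep₂ F u' v' := by
  refine indep₂_of_notMem (fun h => ?_) fun h => huv.notMem ?_
  · exact huv.ne_zero_left ((hL.eq_zero_iff u).1 (hu.eq_zero_iff.1 h))
  · rw [← Set.pair_eq_singleton] at h ⊢
    exact (hL.mem_span_iff_of_proportional hu hu hv).2 h

theorem indep₃ (hL : IsProjective (F := F) L) {u v w u' v' w' : V} (h : Indep₃ F u v w)
    (hu : Proportional F u' (L u)) (hv : Proportional F v' (L v)) (hw : Proportional F w' (L w)) :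
    Indep₃ F u' v' w' :=
  indep₃_of_notMem (hL.indep₂ h.indep₂ hu hv) fun h' =>
    h.notMem ((hL.mem_span_iff_of_proportional hu hv hw).2 h')

/-- The representatives `u'`, `v'` of the images of `u`, `v` are compatible if `u' + v'`
represents the image of `u + v`. -/
structure Compatible (F : Type*) {V : Type*} [Field F] [AddCommGroup V] [Module F V]
    (L : V → V) (u u' v v' : V) : Prop where
  left : Proportional F u' (L u)
  right : Proportional F v' (L v)
  add : Proportional F (u' + v') (L (u + v))

theorem Compatible.symm {u u' v v' : V} (h : Compatible F L u u' v v') :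
    Compatible F L v v' u u' :=
  ⟨h.right, h.left, by rw [add_comm, add_comm v]; exact h.add⟩

/-- Since `u + v` is independent of both `u` and `v`, both coefficients of `L (u + v)` in terms of
`u'` and `L v` are nonzero, so `L v` can be rescaled by their quotient. -/
theorem exists_compatible (hL : IsProjective (F := F) L) {u v u' : V} (huv : Indep₂ F u v)
    (hu : Proportional F u' (L u)) : ∃ v', Compatible F L u u' v v' := by
  have hmem : u + v ∈ span F {u, v} :=
    add_mem (mem_span_pair_left _ _) (mem_span_pair_right _ _)
  obtain ⟨a, b, hab⟩ := mem_span_pair.1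
    ((hL.mem_span_iff_of_proportional hu (Proportional.refl _) (Proportional.refl _)).1 hmem)
  have hi₁ : Indep₂ F u (u + v) := fun s t h => by
    have := huv (s + t) t (by rw [← h]; module)
    grind
  have hi₂ : Indep₂ F v (u + v) := fun s t h => by
    have := huv t (s + t) (by rw [← h]; module)
    grind
  have ha : a ≠ 0 := by
    rintro rfl
    refine (hL.indep₂ hi₂ (Proportional.refl _) (Proportional.refl _)).notMem ?_
    rw [← hab]
    exact mem_span_singleton.2 ⟨b, by simp⟩
  have hb : b ≠ 0 := by
    rintro rfl
    refine (hL.indep₂ hi₁ hu (Proportional.refl _)).notMem ?_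
    rw [← hab]
    exact mem_span_singleton.2 ⟨a, by simp⟩
  refine ⟨(a⁻¹ * b) • L v, hu, ⟨_, mul_ne_zero (inv_ne_zero ha) hb, rfl⟩, a⁻¹, inv_ne_zero ha, ?_⟩
  rw [← hab, smul_add, smul_smul, smul_smul, inv_mul_cancel₀ ha, one_smul]

theorem Compatible.unique (hL : IsProjective (F := F) L) {u v u' v' v'' : V}
    (huv : Indep₂ F u v) (h : Compatible F L u u' v v') (h' : Compatible F L u u' v v'') :
    v' = v'' := by
  obtain ⟨c, -, rfl⟩ := h'.right.trans h.right.symm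
  obtain ⟨k, -, hk⟩ := h'.add.trans h.add.symm
  obtain ⟨h₁, h₂⟩ := hL.indep₂ huv h.left h.right (1 - k) (c - k) (by
    rw [← sub_eq_zero] at hk
    rw [← hk]; module)
  have : c = 1 := by linear_combination h₂ - h₁
  rw [this, one_smul]

/-- The point of `u + v + w` is where the line through `u + v`, `w` meets the line through `u + w`,
`v`; then `v + w` is where the line through `v`, `w` meets the line through `u`, `u + v + w`.
Comparing coefficients of the images identifies both. -/
theorem Compatible.of_indep₃ (hL : IsProjective (F := F) L) {u v w u' v' w' : V}
    (h : Indep₃ F u v w) (hv : Compatible F L u u' v v') (hw : Compatible F L u u' w w') :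
    Compatible F L v v' w w' ∧ Compatible F L u u' (v + w) (v' + w') := by
  have hi := hL.indep₃ h hv.left hv.right hw.right
  have hsum : Proportional F (L (u + (v + w))) (u' + (v' + w')) := by
    obtain ⟨a, b, hab⟩ := mem_span_pair.1 ((hL.mem_span_iff_of_proportional (w := u + (v + w))
      hv.add hw.right (Proportional.refl _)).1 (mem_span_pair.2 ⟨1, 1, by module⟩))
    obtain ⟨c, d, hcd⟩ := mem_span_pair.1 ((hL.mem_span_iff_of_proportional (w := u + (v + w))
      hw.add hv.right (Proportional.refl _)).1 (mem_span_pair.2 ⟨1, 1, by module⟩))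
    obtain ⟨h₁, h₂, h₃⟩ := hi (a - c) (a - d) (b - c) (by
      rw [← sub_eq_zero.2 (hab.trans hcd.symm)]; module)
    refine Proportional.of_eq_smul (k := a) (fun h0 => ?_) ?_
    · have := h 1 1 1 (by rw [← (hL.eq_zero_iff _).1 h0]; module)
      exact one_ne_zero this.1
    · rw [← hab, show b = a by linear_combination h₃ - h₁]; module
  have hadd : Proportional F (L (v + w)) (v' + w') := by
    obtain ⟨a, b, hab⟩ := mem_span_pair.1 ((hL.mem_span_iff_of_proportional (w := v + w)
      hv.right hw.right (Proportional.refl _)).1 (mem_span_pair.2 ⟨1, 1, by module⟩))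
    obtain ⟨c, d, hcd⟩ := mem_span_pair.1 ((hL.mem_span_iff_of_proportional (w := v + w)
      hv.left hsum.symm (Proportional.refl _)).1 (mem_span_pair.2 ⟨-1, 1, by module⟩))
    obtain ⟨h₁, h₂, h₃⟩ := hi (-c - d) (a - d) (b - d) (by
      rw [← sub_eq_zero.2 (hab.trans hcd.symm)]; module)
    refine Proportional.of_eq_smul (k := a) (fun h0 => ?_) ?_
    · have := h 0 1 1 (by rw [← (hL.eq_zero_iff _).1 h0]; module)
      exact one_ne_zero this.2.1
    · rw [← hab, show b = a by linear_combination h₃ - h₂]; module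
  exact ⟨⟨hv.right, hw.right, hadd.symm⟩, hv.left, hadd.symm, hsum.symm⟩

/-- If `w` lies in the span of `u` and `v`, compatibility is passed through an auxiliary vector
outside that span. -/
theorem Compatible.trans (hL : IsProjective (F := F) L) (hdim : ∀ u v : V, ∃ w, w ∉ span F {u, v})
    {u v w u' v' w' : V} (huv : Indep₂ F u v) (huw : Indep₂ F u w) (hvw : Indep₂ F v w)
    (hv : Compatible F L u u' v v') (hw : Compatible F L u u' w w') :
    Compatible F L v v' w w' := by
  by_cases hmem : w ∈ span F {u, v}
  · obtain ⟨x, hx⟩ := hdim u v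
    have hxuv := indep₃_of_notMem huv hx
    have hxuw : Indep₃ F u w x := indep₃_of_notMem huw fun h =>
      hx (span_pair_le (mem_span_pair_left _ _) hmem h)
    have hxvw : Indep₃ F v w x := indep₃_of_notMem hvw fun h =>
      hx (span_pair_le (mem_span_pair_right _ _) hmem h)
    obtain ⟨x', hx'⟩ := hL.exists_compatible hxuv.swap₂₃.indep₂ hv.left
    have h₁ := (Compatible.of_indep₃ hL hxuv.swap₂₃ hx' hv).1
    have h₂ := (Compatible.of_indep₃ hL hxuw.swap₂₃ hx' hw).1
    exact (Compatible.of_indep₃ hL hxvw.swap₂₃.swap₁₂ h₁ h₂).1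
  · exact (Compatible.of_indep₃ hL (indep₃_of_notMem huv hmem) hv hw).1

/-- Representatives are calibrated against `e₀`. Multiples of `e₀` are not independent of it, so
they are calibrated against a second vector `e₁`, itself calibrated against `e₀`. -/
theorem exists_compatible_lift (hL : IsProjective (F := F) L)
    (hdim : ∀ u v : V, ∃ w, w ∉ span F {u, v}) :
    ∃ φ : V → V, (∀ v, Proportional F (φ v) (L v)) ∧
      ∀ u v, Indep₂ F u v → Compatible F L u (φ u) v (φ v) := by
  obtain ⟨e₀, he₀⟩ := hdim 0 0
  have he₀ : e₀ ≠ 0 := fun h => he₀ (by rw [h]; exact zero_mem _)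
  obtain ⟨e₁, he₁⟩ := hdim e₀ e₀
  rw [Set.pair_eq_singleton] at he₁
  have he := indep₂_of_notMem he₀ he₁
  obtain ⟨e₁', he'⟩ := hL.exists_compatible he (Proportional.refl (F := F) (L e₀))
  have key : ∀ v, ∃ v', Proportional F v' (L v) ∧
      (v ∉ span F {e₀} → Compatible F L e₀ (L e₀) v v') ∧
      (v ∈ span F {e₀} → v ≠ 0 → Compatible F L e₁ e₁' v v') := by
    intro v
    by_cases hv : v ∈ span F {e₀}
    · by_cases hv0 : v = 0
      · exact ⟨L v, Proportional.refl _, fun h => absurd hv h, fun _ h => absurd hv0 h⟩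
      · have hi : Indep₂ F e₁ v := by
          obtain ⟨c, rfl⟩ := mem_span_singleton.1 hv
          have hc : c ≠ 0 := by rintro rfl; simp at hv0
          intro a b hab
          have := he (b * c) a (by rw [← hab]; module)
          grind
        obtain ⟨v', hv'⟩ := hL.exists_compatible hi he'.right
        exact ⟨v', hv'.right, fun h => absurd hv h, fun _ _ => hv'⟩
    · obtain ⟨v', hv'⟩ := hL.exists_compatible (indep₂_of_notMem he₀ hv)
        (Proportional.refl (F := F) (L e₀))
      exact ⟨v', hv'.right, fun _ => hv', fun h => absurd h hv⟩
  choose φ hφ hφ₀ hφ₁ using key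
  have mixed : ∀ u v, Indep₂ F u v → u ∈ span F {e₀} → Compatible F L u (φ u) v (φ v) := by
    intro u v huv hu
    have hu0 := huv.ne_zero_left
    have huspan : span F {u} = span F {e₀} := by
      obtain ⟨c, rfl⟩ := mem_span_singleton.1 hu
      have hc : c ≠ 0 := by rintro rfl; simp at hu0
      exact span_singleton_smul_eq hc.isUnit e₀
    have hv : v ∉ span F {e₀} := huspan ▸ huv.notMem
    have hv₀ := indep₂_of_notMem he₀ hv
    have hue₁ : Indep₂ F u e₁ := indep₂_of_notMem hu0 (huspan ▸ he₁)
    -- A common partner `x` links the two calibrations: it becomes compatible with `u` through `e₁`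
    -- and with `v` through `e₀`.
    obtain ⟨x, hx⟩ : ∃ x, Indep₂ F e₁ x ∧ Indep₂ F e₀ x ∧ Indep₂ F u x ∧ Indep₂ F v x := by
      by_cases hv₁ : v ∈ span F {e₁}
      · obtain ⟨x, hx⟩ := hdim e₀ e₁
        have hxe := indep₃_of_notMem he hx
        have h₀ := hxe.swap₂₃.indep₂
        have h₁ := hxe.swap₁₂.swap₂₃.indep₂
        refine ⟨x, h₁, h₀, indep₂_of_notMem hu0 (huspan ▸ h₀.notMem),
          indep₂_of_notMem hv₀.ne_zero_right fun h => h₁.notMem ?_⟩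
        exact span_le.2 (Set.singleton_subset_iff.2 hv₁) h
      · have hi : Indep₂ F e₁ v := indep₂_of_notMem he.ne_zero_right hv₁
        obtain ⟨x, hx⟩ := hdim e₁ v
        have hx₃ := indep₃_of_notMem hi hx
        by_cases hx₀ : x ∈ span F {e₀}
        · refine ⟨x + e₁, ?_⟩
          obtain ⟨c, rfl⟩ := mem_span_singleton.1 hx₀
          have hc : c ≠ 0 := by rintro rfl; simp at hx
          refine ⟨fun a b h => ?_, fun a b h => ?_, ?_, fun a b h => ?_⟩
          · have := he (b * c) (a + b) (by rw [← h]; module)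
            grind
          · have := he (a + b * c) b (by rw [← h]; module)
            grind
          · refine indep₂_of_notMem hu0 (huspan ▸ fun h => he₁ ?_)
            have := sub_mem h hx₀
            simpa using this
          · have := hx₃ b a b (by rw [← h]; module)
            exact ⟨this.2.1, this.1⟩
        · exact ⟨x, hx₃.swap₂₃.indep₂, indep₂_of_notMem he₀ hx₀,
            indep₂_of_notMem hu0 (huspan ▸ hx₀), hx₃.swap₁₂.swap₂₃.indep₂⟩
    obtain ⟨hx₁, hx₀, hxu, hxv⟩ := hx
    have c₀ := hφ₀ x hx₀.notMem
    have c₁ := Compatible.trans hL hdim he hx₀ hx₁ he' c₀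
    have c₂ := Compatible.trans hL hdim hx₁ hue₁.symm hxu.symm c₁ (hφ₁ u hu hu0)
    have c₃ := Compatible.trans hL hdim hx₀ hv₀ hxv.symm c₀ (hφ₀ v hv)
    exact Compatible.trans hL hdim hxu.symm hxv.symm huv c₂ c₃
  refine ⟨φ, hφ, fun u v huv => ?_⟩
  by_cases hu : u ∈ span F {e₀}
  · exact mixed u v huv hu
  by_cases hv : v ∈ span F {e₀}
  · exact (mixed v u huv.symm hv).symm
  exact Compatible.trans hL hdim (indep₂_of_notMem he₀ hu) (indep₂_of_notMem he₀ hv) huv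
    (hφ₀ u hu) (hφ₀ v hv)

/-- The fundamental theorem of projective geometry: a map of points preserving and reflecting
collinearity is induced by a semilinear map. -/
theorem exists_semilinear (hL : IsProjective (F := F) L)
    (hdim : ∀ u v : V, ∃ w, w ∉ span F {u, v}) :
    ∃ (σ : F →+* F) (φ : V →ₛₗ[σ] V), ∀ v, Proportional F (φ v) (L v) := by
  obtain ⟨φ, hφ, hcomp⟩ := hL.exists_compatible_lift hdim
  have hφ0 : ∀ v, φ v = 0 ↔ v = 0 := fun v => (hφ v).eq_zero_iff.trans (hL.eq_zero_iff v)
  have hindep : ∀ u v, Indep₂ F u v → Indep₂ F (φ u) (φ v) := fun u v h =>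
    hL.indep₂ h (hφ u) (hφ v)
  have exists_indep : ∀ u : V, u ≠ 0 → ∃ w, Indep₂ F u w := fun u hu => by
    obtain ⟨w, hw⟩ := hdim u u
    rw [Set.pair_eq_singleton] at hw
    exact ⟨w, indep₂_of_notMem hu hw⟩
  have add_indep : ∀ u v, Indep₂ F u v → φ (u + v) = φ u + φ v := by
    intro u v huv
    obtain ⟨w, hw⟩ := hdim u v
    have hi := (indep₃_of_notMem huv hw).swap₂₃.swap₁₂
    have h := (Compatible.of_indep₃ hL hi (hcomp w u hi.indep₂)
      (hcomp w v hi.swap₂₃.indep₂)).2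
    have hi' : Indep₂ F w (u + v) := fun a b hab => by
      have := hi a b b (by rw [← hab]; module)
      exact ⟨this.1, this.2.1⟩
    exact Compatible.unique hL hi' (hcomp _ _ hi') h
  have add : ∀ u v, φ (u + v) = φ u + φ v := by
    intro u v
    by_cases hu : u = 0
    · simp [hu, (hφ0 0).2 rfl]
    by_cases hv : v ∈ span F {u}
    · obtain ⟨c, rfl⟩ := mem_span_singleton.1 hv
      by_cases hc : c = 0
      · simp [hc, (hφ0 0).2 rfl]
      -- A dependent pair is handled by expanding `φ (u + (c • u + w))` in two ways; only when `u +
      -- c • u = 0` is the regrouped pair not independent.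
      obtain ⟨w, hw⟩ := exists_indep u hu
      have h₁ := add_indep u (c • u + w) fun a b hab => by
        have := hw (a + b * c) b (by rw [← hab]; module)
        grind
      have h₂ := add_indep (c • u) w fun a b hab => by
        have := hw (a * c) b (by rw [← hab]; module)
        grind
      by_cases hc1 : 1 + c = 0
      · have h₃ : u + c • u = 0 := by rw [← zero_smul F u, ← hc1]; module
        rw [h₂, ← add_assoc, h₃, zero_add, ← add_assoc, right_eq_add] at h₁
        rw [h₃, (hφ0 0).2 rfl, h₁]
      · have h₃ := add_indep (u + c • u) w fun a b hab => by
          have := hw (a * (1 + c)) b (by rw [← hab]; module)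
          grind
        rw [h₂, ← add_assoc, h₃, ← add_assoc] at h₁
        exact add_right_cancel h₁
    · exact add_indep u v (indep₂_of_notMem hu hv)
  have smul_exists : ∀ (c : F) v, ∃ s : F, φ (c • v) = s • φ v := by
    intro c v
    by_cases hv : v = 0
    · exact ⟨0, by simp [hv, (hφ0 0).2 rfl]⟩
    have h := (hL.mem_span_iff_of_proportional (hφ v) (hφ v) (hφ (c • v))).1
      (smul_mem _ _ (mem_span_pair_left _ _))
    rw [Set.pair_eq_singleton, mem_span_singleton] at h
    obtain ⟨s, hs⟩ := h
    exact ⟨s, hs.symm⟩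
  choose s hs using smul_exists
  -- Expanding `φ (c • (u + v))` in two ways shows that the scalar factor is the same for `u` and
  -- `v`.
  have s_eq_indep : ∀ c u v, Indep₂ F u v → s c u = s c v := by
    intro c u v huv
    have h : s c (u + v) • (φ u + φ v) = s c u • φ u + s c v • φ v := by
      rw [← add, ← hs, ← hs, ← hs, smul_add, add]
    obtain ⟨h₁, h₂⟩ := hindep u v huv (s c (u + v) - s c u) (s c (u + v) - s c v) (by
      rw [← sub_eq_zero.2 h]; module)
    linear_combination h₂ - h₁
  have s_eq : ∀ c u v, u ≠ 0 → v ≠ 0 → s c u = s c v := by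
    intro c u v hu hv
    obtain ⟨w, hw⟩ := hdim u v
    have hwu : w ∉ span F {u} := fun h => hw (span_mono (by simp) h)
    have hwv : w ∉ span F {v} := fun h => hw (span_mono (by simp) h)
    rw [s_eq_indep c u w (indep₂_of_notMem hu hwu), s_eq_indep c v w (indep₂_of_notMem hv hwv)]
  obtain ⟨e, he⟩ := hdim 0 0
  have he : e ≠ 0 := fun h => he (by rw [h]; exact zero_mem _)
  have hφe : φ e ≠ 0 := fun h => he ((hφ0 e).1 h)
  have hse : ∀ c v, φ (c • v) = s c e • φ v := by
    intro c v
    by_cases hv : v = 0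
    · simp [hv, (hφ0 0).2 rfl]
    · rw [hs, s_eq c v e hv he]
  have inj := smul_left_injective F hφe
  let σ : F →+* F :=
    { toFun := fun c => s c e
      map_one' := inj (by simp only [← hse, one_smul])
      map_mul' := fun a b => inj (by
        simp only [mul_smul, ← hse])
      map_zero' := inj (by simp only [← hse, zero_smul, (hφ0 0).2 rfl])
      map_add' := fun a b => inj (by simp only [← hse, add_smul, add]) }
  exact ⟨σ, { toFun := φ, map_add' := add, map_smul' := hse }, hφ⟩

end IsProjective

end Fundamental

end IncidenceGroup

namespace IncidenceGroup

/-! ### Irreducible polynomials over real closed fields -/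

section RealClosed

open Polynomial IntermediateField

theorem finrank_eq_one_of_odd {F E : Type*} [Field F] [Field E] [Algebra F E]
    (hF : ∀ f : F[X], Odd f.natDegree → ∃ x, f.IsRoot x) [FiniteDimensional F E]
    (hodd : Odd (Module.finrank F E)) : Module.finrank F E = 1 := by
  rw [← Subalgebra.bot_eq_top_iff_finrank_eq_one, Algebra.eq_top_iff]
  intro x
  have hx := Algebra.IsIntegral.isIntegral (R := F) x
  have hdeg : Odd (minpoly F x).natDegree := hodd.of_dvd_nat (minpoly.degree_dvd hx)
  obtain ⟨r, hr⟩ := hF _ hdeg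
  exact minpoly.mem_range_of_degree_eq_one F x
    (degree_eq_one_of_irreducible_of_root (minpoly.irreducible hx) hr)

theorem finrank_ne_two_of_isSquare {K E : Type*} [Field K] [Field E] [Algebra K E]
    [NeZero (2 : K)] (hK : ∀ x : K, IsSquare x) : Module.finrank K E ≠ 2 := by
  intro h2
  have : FiniteDimensional K E := Module.finite_of_finrank_eq_succ h2
  have htop : (⊥ : Subalgebra K E) = ⊤ := by
    rw [Algebra.eq_top_iff]
    intro x
    have hx := Algebra.IsIntegral.isIntegral (R := K) x
    have hirr := minpoly.irreducible hx
    have hdvd : (minpoly K x).natDegree ∣ 2 := h2 ▸ minpoly.degree_dvd hx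
    refine minpoly.mem_range_of_degree_eq_one K x ?_
    rcases (Nat.dvd_prime Nat.prime_two).1 hdvd with h | h
    · rw [degree_eq_natDegree hirr.ne_zero, h]; rfl
    · have hlead : (minpoly K x).coeff 2 = 1 := by
        have := (minpoly.monic hx).coeff_natDegree
        rwa [h] at this
      obtain ⟨s, hs⟩ := hK (discrim 1 ((minpoly K x).coeff 1) ((minpoly K x).coeff 0))
      obtain ⟨r, hr⟩ := exists_quadratic_eq_zero one_ne_zero ⟨s, hs⟩
      refine degree_eq_one_of_irreducible_of_root hirr (x := r) ?_
      rw [IsRoot.def, eval_eq_sum_range, h, Finset.sum_range_succ, Finset.sum_range_succ,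
        Finset.sum_range_one, hlead]
      linear_combination hr
  rw [Subalgebra.bot_eq_top_iff_finrank_eq_one] at htop
  omega

variable {F : Type*} [Field F] [IsRealClosed F]

theorem sq_add_sq_eq_zero {a b : F} (h : a ^ 2 + b ^ 2 = 0) : a = 0 ∧ b = 0 := by
  have hb : b = 0 := by
    by_contra hb
    refine IsSemireal.one_add_ne_zero (IsSquare.isSumSq ⟨a / b, rfl⟩) ?_
    field_simp
    linear_combination h
  subst hb
  exact ⟨by simpa using h, rfl⟩

/-- Otherwise `-(a ^ 2 + b ^ 2) = c ^ 2`, and dividing by `b ^ 2` writes `-1` as a sum of squares.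
-/
theorem isSquare_sq_add_sq (a b : F) : IsSquare (a ^ 2 + b ^ 2) := by
  rcases IsRealClosed.isSquare_or_isSquare_neg (a ^ 2 + b ^ 2) with h | ⟨c, hc⟩
  · exact h
  · by_cases hb : b = 0
    · exact ⟨a, by rw [hb]; ring⟩
    · exfalso
      refine IsSemireal.one_add_ne_zero
        (((IsSquare.isSumSq ⟨a / b, rfl⟩).add (IsSquare.isSumSq ⟨c / b, rfl⟩))) ?_
      field_simp
      linear_combination -hc

theorem isSquare_add_mul_sqrt_neg_one {E : Type*} [Field E] [Algebra F E] {i : E}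
    (hi : i ^ 2 = -1) (a b : F) :
    ∃ x y : F, algebraMap F E a + algebraMap F E b * i =
      (algebraMap F E x + algebraMap F E y * i) ^ 2 := by
  have of_eq : ∀ {x y : F}, x ^ 2 - y ^ 2 = a → 2 * x * y = b →
      algebraMap F E a + algebraMap F E b * i =
        (algebraMap F E x + algebraMap F E y * i) ^ 2 := by
    rintro x y rfl rfl
    simp only [map_sub, map_mul, map_pow, map_ofNat]
    linear_combination -(algebraMap F E y) ^ 2 * hi
  by_cases hb : b = 0
  · rcases IsRealClosed.isSquare_or_isSquare_neg a with ⟨s, hs⟩ | ⟨s, hs⟩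
    · exact ⟨s, 0, of_eq (by rw [hs]; ring) (by rw [hb]; ring)⟩
    · exact ⟨0, s, of_eq (by linear_combination hs) (by rw [hb]; ring)⟩
  obtain ⟨r, hr⟩ := isSquare_sq_add_sq a b
  -- Here `u` and `v` stand for `x ^ 2` and `-y ^ 2`, the roots `(a ± r) / 2` of `T ^ 2 - a T - b ^
  -- 2 / 4`. As their product is minus a square, one of them is a square.
  have key : ∃ u v x : F, u + v = a ∧ u * v = -b ^ 2 / 4 ∧ u = x * x := by
    rcases IsRealClosed.isSquare_or_isSquare_neg ((a + r) / 2) with ⟨x, hx⟩ | ⟨x, hx⟩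
    · exact ⟨(a + r) / 2, (a - r) / 2, x, by ring, by linear_combination hr / 4, hx⟩
    · have hx0 : x ≠ 0 := by
        rintro rfl
        have hra : r = -a := by linear_combination -2 * hx
        rw [hra] at hr
        exact hb (pow_eq_zero_iff two_ne_zero |>.1 (by linear_combination hr))
      refine ⟨(a - r) / 2, (a + r) / 2, b / (2 * x), by ring, by linear_combination hr / 4, ?_⟩
      field_simp
      linear_combination -2 * (a - r) * hx - hr
  obtain ⟨u, v, x, huv, hmul, rfl⟩ := key
  have hx : x ≠ 0 := by
    rintro rfl
    exact hb (pow_eq_zero_iff two_ne_zero |>.1 (by linear_combination 4 * hmul))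
  refine ⟨x, b / (2 * x), of_eq ?_ (by field_simp)⟩
  have hv : v = -b ^ 2 / 4 / (x * x) := by
    rw [eq_div_iff (mul_ne_zero hx hx), mul_comm]; exact hmul
  rw [← huv, hv]
  field_simp
  ring

theorem exists_eq_add_mul_of_mem_adjoin {E : Type*} [Field E] [Algebra F E] {i : E}
    (hi : i ^ 2 = -1) {z : E} (hz : z ∈ F⟮i⟯) :
    ∃ a b : F, z = algebraMap F E a + algebraMap F E b * i := by
  induction hz using IntermediateField.adjoin_induction with
  | mem z hz => exact ⟨0, 1, by simpa using hz⟩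
  | algebraMap a => exact ⟨a, 0, by simp⟩
  | add z w _ _ hz hw =>
    obtain ⟨a, b, rfl⟩ := hz
    obtain ⟨c, d, rfl⟩ := hw
    exact ⟨a + c, b + d, by simp only [map_add]; ring⟩
  | mul z w _ _ hz hw =>
    obtain ⟨a, b, rfl⟩ := hz
    obtain ⟨c, d, rfl⟩ := hw
    refine ⟨a * c - b * d, a * d + b * c, ?_⟩
    simp only [map_add, map_mul, map_sub]
    linear_combination (algebraMap F E b) * (algebraMap F E d) * hi
  | inv z _ hz =>
    obtain ⟨a, b, rfl⟩ := hz
    by_cases h0 : a ^ 2 + b ^ 2 = 0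
    · obtain ⟨rfl, rfl⟩ := sq_add_sq_eq_zero h0
      exact ⟨0, 0, by simp⟩
    · refine ⟨a / (a ^ 2 + b ^ 2), -b / (a ^ 2 + b ^ 2), ?_⟩
      have h0' : (algebraMap F E a) ^ 2 + (algebraMap F E b) ^ 2 ≠ 0 := by
        rw [← map_pow, ← map_pow, ← map_add]
        exact (_root_.map_ne_zero _).2 h0
      refine inv_eq_of_mul_eq_one_right ?_
      simp only [map_div₀, map_add, map_pow, map_neg]
      field_simp
      linear_combination -(algebraMap F E b) ^ 2 * hi

/-- A finite Galois extension of a real closed field which contains a square root of `-1` has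
degree two. -/
theorem finrank_eq_two_of_isGalois {L : Type*} [Field L] [Algebra F L] [FiniteDimensional F L]
    [IsGalois F L] {i : L} (hi : i ^ 2 = -1) : Module.finrank F L = 2 := by
  have : Fact (Nat.Prime 2) := ⟨Nat.prime_two⟩
  obtain ⟨m, hm⟩ : ∃ m, Module.finrank F L = 2 ^ m := by
    -- The fixed field of a Sylow 2-subgroup has odd degree over `F`, hence degree one.
    let S : Sylow 2 (L ≃ₐ[F] L) := default
    have hmul := Module.finrank_mul_finrank F (fixedField (S : Subgroup (L ≃ₐ[F] L))) L
    rw [finrank_fixedField_eq_card, ← IsGalois.card_aut_eq_finrank F L,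
      ← (S : Subgroup (L ≃ₐ[F] L)).index_mul_card] at hmul
    have hidx := Nat.eq_of_mul_eq_mul_right Nat.card_pos hmul
    have hone := finrank_eq_one_of_odd (F := F)
      (E := fixedField (S : Subgroup (L ≃ₐ[F] L)))
      (fun f hf => IsRealClosed.exists_isRoot_of_odd_natDegree hf) (by
        rw [hidx, ← Nat.not_even_iff_odd, even_iff_two_dvd]
        exact S.not_dvd_index)
    obtain ⟨m, hm⟩ := IsPGroup.iff_card.1 S.isPGroup'
    refine ⟨m, ?_⟩
    rw [← Module.finrank_mul_finrank F (fixedField (S : Subgroup (L ≃ₐ[F] L))) L, hone,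
      finrank_fixedField_eq_card, one_mul]
    exact hm
  have hsq : ∀ x : F⟮i⟯, IsSquare x := by
    rintro ⟨z, hz⟩
    obtain ⟨a, b, rfl⟩ := exists_eq_add_mul_of_mem_adjoin hi hz
    obtain ⟨x, y, hxy⟩ := isSquare_add_mul_sqrt_neg_one hi a b
    refine ⟨⟨algebraMap F L x + algebraMap F L y * i, ?_⟩, ?_⟩
    · exact add_mem (_root_.algebraMap_mem _ _)
        (mul_mem (_root_.algebraMap_mem _ _) (mem_adjoin_simple_self F i))
    · exact Subtype.ext (hxy.trans (sq _))
  have hchar : NeZero (2 : F⟮i⟯) := by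
    have : CharZero F⟮i⟯ := charZero_of_injective_algebraMap (algebraMap F F⟮i⟯).injective
    infer_instance
  have hi2 : Module.finrank F F⟮i⟯ = 2 := by
    have hle : (minpoly F i).natDegree ≤ 2 := by
      have h := minpoly.min F i (p := X ^ 2 + 1) (by monicity!) (by simp [hi])
      have h2 : (X ^ 2 + 1 : F[X]).natDegree = 2 := by compute_degree!
      rw [← h2]
      exact natDegree_le_natDegree h
    have hint : IsIntegral F i := Algebra.IsIntegral.isIntegral i
    rw [adjoin.finrank hint]
    have hpos := minpoly.natDegree_pos hint
    refine le_antisymm hle (Nat.succ_le_of_lt (lt_of_le_of_ne hpos fun h1 => ?_))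
    obtain ⟨r, hr⟩ := minpoly.natDegree_eq_one_iff.1 h1.symm
    rw [← hr, ← map_pow, ← map_one (algebraMap F L), ← map_neg] at hi
    have := (algebraMap F L).injective hi
    exact one_ne_zero (sq_add_sq_eq_zero (a := r) (b := 1) (by rw [this]; ring)).2
  have htower := Module.finrank_mul_finrank F F⟮i⟯ L
  rw [hi2, hm] at htower
  suffices h : Module.finrank F⟮i⟯ L = 1 by rw [hm, ← htower, h]
  obtain ⟨k, -, hk⟩ := (Nat.dvd_prime_pow Nat.prime_two).1 (Dvd.intro_left _ htower)
  rcases k with _ | k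
  · simpa using hk
  exfalso
  -- A subgroup of index two would give a quadratic extension of `F⟮i⟯`, in which every element is a
  -- square.
  obtain ⟨H, hH⟩ := Sylow.exists_subgroup_card_pow_prime (G := L ≃ₐ[F⟮i⟯] L) 2 (n := k) (by
    rw [IsGalois.card_aut_eq_finrank, hk]
    exact pow_dvd_pow 2 k.le_succ)
  have h := Module.finrank_mul_finrank F⟮i⟯ (fixedField H) L
  rw [finrank_fixedField_eq_card, hH, hk, pow_succ'] at h
  exact finrank_ne_two_of_isSquare hsq (Nat.eq_of_mul_eq_mul_right (by positivity) h)

theorem natDegree_le_two_of_irreducible {p : F[X]} (hp : Irreducible p) : p.natDegree ≤ 2 := by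
  -- The factor `X ^ 2 + 1` puts a square root of `-1` into the splitting field.
  let q : F[X] := p * (X ^ 2 + 1)
  let L := q.SplittingField
  have hX : (X ^ 2 + 1 : F[X]).natDegree = 2 := by compute_degree!
  have hX0 : (X ^ 2 + 1 : F[X]) ≠ 0 := fun h => by simp [h] at hX
  have hq : q.map (algebraMap F L) ≠ 0 :=
    (Polynomial.map_ne_zero_iff (algebraMap F L).injective).2 (mul_ne_zero hp.ne_zero hX0)
  have hsplit := SplittingField.splits q
  have hgal : IsGalois F L := ⟨⟩
  have h₁ := hsplit.of_dvd hq (Polynomial.map_dvd _ (Dvd.intro _ rfl : p ∣ q))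
  have h₂ := hsplit.of_dvd hq (Polynomial.map_dvd _ (Dvd.intro_left _ rfl : X ^ 2 + 1 ∣ q))
  obtain ⟨i, hi⟩ := h₂.exists_eval_eq_zero (by
    rw [degree_map, degree_eq_natDegree hX0, hX]; decide)
  obtain ⟨θ, hθ⟩ := h₁.exists_eval_eq_zero (by
    rw [degree_map]; exact (degree_pos_of_irreducible hp).ne')
  rw [eval_map_algebraMap] at hi hθ
  have h2 : Module.finrank F L = 2 := finrank_eq_two_of_isGalois (i := i) (by
    simp only [map_add, map_pow, aeval_X, map_one] at hi
    linear_combination hi)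
  rw [← natDegree_mul_C (inv_ne_zero (leadingCoeff_ne_zero.2 hp.ne_zero)),
    minpoly.eq_of_irreducible hp hθ, ← h2]
  exact minpoly.natDegree_le θ

end RealClosed

/-! ### Small invariant subspaces of endomorphisms -/

section Endomorphism

open Polynomial

variable {F V : Type*} [Field F] [AddCommGroup V] [Module F V] [FiniteDimensional F V]
  [Nontrivial V]

/-- An endomorphism over a field whose irreducible polynomials have degree at most two has an
invariant subspace of dimension at most two. -/
theorem exists_apply_apply_mem_span (hF : ∀ p : F[X], Irreducible p → p.natDegree ≤ 2)
    (C : V →ₗ[F] V) : ∃ w, w ≠ 0 ∧ C (C w) ∈ Submodule.span F {w, C w} := by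
  have hint : IsIntegral F C := Algebra.IsIntegral.isIntegral C
  obtain ⟨q, hq, r, hr⟩ := exists_irreducible_of_natDegree_pos (minpoly.natDegree_pos hint)
  -- By minimality the cofactor `r` does not annihilate `V`; a nonzero vector in the image of `r(C)`
  -- is killed by `q(C)`.
  have hr0 : aeval C r ≠ 0 := by
    intro h
    have hr' : r ≠ 0 := by
      rintro rfl
      exact minpoly.ne_zero hint (by rw [hr, mul_zero])
    have hle := natDegree_le_of_dvd (minpoly.dvd F C h) hr'
    rw [hr, natDegree_mul hq.ne_zero hr'] at hle
    have := hq.natDegree_pos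
    omega
  obtain ⟨v, hv⟩ : ∃ v, aeval C r v ≠ 0 := by
    by_contra! h
    exact hr0 (LinearMap.ext h)
  have hqv : aeval C q (aeval C r v) = 0 := by
    rw [← Module.End.mul_apply, ← map_mul, ← hr, minpoly.aeval]; rfl
  refine ⟨_, hv, ?_⟩
  generalize aeval C r v = w at hqv
  have hdeg := hF q hq
  have hpos := hq.natDegree_pos
  have hlead := leadingCoeff_ne_zero.2 hq.ne_zero
  rw [leadingCoeff] at hlead
  rw [aeval_eq_sum_range] at hqv
  obtain h | h : q.natDegree = 1 ∨ q.natDegree = 2 := by omega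
  · rw [h] at hlead hqv
    simp only [Finset.sum_range_succ, Finset.sum_range_zero, zero_add, pow_zero, pow_one,
      LinearMap.add_apply, LinearMap.smul_apply, Module.End.one_apply] at hqv
    refine (Submodule.smul_mem_iff _ hlead).1 (Submodule.mem_span_pair.2 ⟨0, -q.coeff 0, ?_⟩)
    rw [← map_smul, ← map_smul, zero_smul, zero_add, ← sub_eq_zero, ← map_sub, ← neg_eq_zero,
      ← map_neg, ← map_zero C, ← hqv]
    congr 1
    module
  · rw [h] at hlead hqv
    simp only [Finset.sum_range_succ, Finset.sum_range_zero, zero_add, pow_zero, pow_one,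
      LinearMap.add_apply, LinearMap.smul_apply, Module.End.one_apply, pow_two,
      Module.End.mul_apply] at hqv
    refine (Submodule.smul_mem_iff _ hlead).1
      (Submodule.mem_span_pair.2 ⟨-q.coeff 0, -q.coeff 1, ?_⟩)
    rw [← sub_eq_zero, ← neg_eq_zero, ← hqv]
    module

end Endomorphism

end IncidenceGroup

/-! ### The multiplication on vectors and its contradiction -/

namespace IncidenceGroup

open Submodule Polynomial

variable {F V : Type*} [Field F] [AddCommGroup V] [Module F V]

/-- A family of semilinear maps, one for each vector, which represents the translations of an
abelian group structure on the points of the projective space of `V`; the vector `neutral` represents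
the neutral element. -/
structure Multiplication (F V : Type*) [Field F] [AddCommGroup V] [Module F V] where
  neutral : V
  neutral_ne_zero : neutral ≠ 0
  twist : V → F →+* F
  mul : ∀ x : V, V →ₛₗ[twist x] V
  mul_neutral : ∀ x, x ≠ 0 → mul x neutral = x
  mul_apply_ne_zero : ∀ x y, x ≠ 0 → y ≠ 0 → mul x y ≠ 0
  comm : ∀ x y, x ≠ 0 → y ≠ 0 → Proportional F (mul x y) (mul y x)
  assoc : ∀ x y z, x ≠ 0 → y ≠ 0 → z ≠ 0 →
    Proportional F (mul x (mul y z)) (mul (mul x y) z)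
  exists_mul : ∀ x y, x ≠ 0 → y ≠ 0 → ∃ z, z ≠ 0 ∧ Proportional F (mul x z) y
  left_cancel : ∀ x y z, x ≠ 0 → y ≠ 0 → z ≠ 0 → Proportional F (mul x y) (mul x z) →
    Proportional F y z
  mul_mem_span_iff : ∀ x u v w, x ≠ 0 →
    (w ∈ span F {u, v} ↔ mul x w ∈ span F {mul x u, mul x v})

namespace Multiplication

variable (M : Multiplication F V)

theorem ne_zero_of_notMem {x : V} (hx : x ∉ span F {M.neutral}) : x ≠ 0 :=
  fun h => hx (by rw [h]; exact zero_mem _)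

theorem mul_congr_right {x y z : V} (h : Proportional F y z) :
    Proportional F (M.mul x y) (M.mul x z) := by
  obtain ⟨k, hk, rfl⟩ := h
  exact ⟨M.twist x k, (_root_.map_ne_zero _).2 hk, map_smulₛₗ _ _ _⟩

theorem mul_congr_left {x y z : V} (hx : x ≠ 0) (hy : y ≠ 0) (hz : z ≠ 0)
    (h : Proportional F y z) : Proportional F (M.mul y x) (M.mul z x) :=
  ((M.comm y x hy hx).trans (M.mul_congr_right h)).trans (M.comm x z hx hz)

theorem right_cancel {x y z : V} (hx : x ≠ 0) (hy : y ≠ 0) (hz : z ≠ 0)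
    (h : Proportional F (M.mul y x) (M.mul z x)) : Proportional F y z :=
  M.left_cancel x y z hx hy hz (((M.comm x y hx hy).trans h).trans (M.comm z x hz hx))

theorem neutral_mul {x : V} (hx : x ≠ 0) : Proportional F (M.mul M.neutral x) x := by
  simpa only [M.mul_neutral x hx] using M.comm M.neutral x M.neutral_ne_zero hx

theorem mem_span_neutral_of_mul_eq {x y : V} {k : F} (hy : y ≠ 0) (h : M.mul x y = k • y) :
    x ∈ span F {M.neutral} := by
  by_cases hx : x = 0
  · rw [hx]; exact zero_mem _
  have h₁ := Proportional.of_eq_smul (M.mul_apply_ne_zero x y hx hy) h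
  obtain ⟨c, -, hc⟩ := M.right_cancel hy hx M.neutral_ne_zero (h₁.trans (M.neutral_mul hy).symm)
  exact mem_span_singleton.2 ⟨c, hc.symm⟩

theorem indep₂_mul {x y : V} (hx : x ∉ span F {M.neutral}) (hy : y ≠ 0) :
    Indep₂ F y (M.mul x y) := by
  refine indep₂_of_notMem hy fun h => ?_
  obtain ⟨k, hk⟩ := mem_span_singleton.1 h
  exact hx (M.mem_span_neutral_of_mul_eq hy hk.symm)

theorem indep₂_neutral {x : V} (hx : x ∉ span F {M.neutral}) : Indep₂ F M.neutral x :=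
  indep₂_of_notMem M.neutral_ne_zero hx

theorem neutral_add_notMem {x : V} (hx : x ∉ span F {M.neutral}) : M.neutral + x ∉ span F {M.neutral} :=
  fun h => hx (by simpa using sub_mem h (mem_span_singleton_self M.neutral))

theorem exists_mul_neutral_add_eq {x y : V} (hx : x ∉ span F {M.neutral}) (hy : y ≠ 0) :
    ∃ f g : F, f ≠ 0 ∧ g ≠ 0 ∧ M.mul (M.neutral + x) y = f • y + g • M.mul x y := by
  have hx0 := M.ne_zero_of_notMem hx
  have h0 := M.ne_zero_of_notMem (M.neutral_add_notMem hx)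
  obtain ⟨k, hk, h⟩ := M.comm (M.neutral + x) y h0 hy
  obtain ⟨l, hl, h'⟩ := M.comm y x hy hx0
  refine ⟨k, k * l, hk, mul_ne_zero hk hl, ?_⟩
  rw [h, map_add, M.mul_neutral y hy, h', smul_add, smul_smul]

/-- Multiplication by `w` carries `neutral`, `x`, `x * x` to the points of `w`, `x * w`, `x * (x *
w)`, so collinearity can be pulled back. -/
theorem mul_mul_self_mem_span {x w : V} (hx : x ≠ 0) (hw : w ≠ 0)
    (h : M.mul x (M.mul x w) ∈ span F {w, M.mul x w}) :
    M.mul x x ∈ span F {M.neutral, x} := by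
  have hxx := M.mul_apply_ne_zero x x hx hx
  rw [M.mul_mem_span_iff w _ _ _ hw, M.mul_neutral w hw]
  have h₁ : Proportional F (M.mul w (M.mul x x)) (M.mul x (M.mul x w)) :=
    (M.comm w _ hw hxx).trans (M.assoc x x w hx hx hw).symm
  rw [h₁.mem_iff]
  refine span_pair_le (mem_span_pair_left _ _) ?_ h
  exact ((M.comm w x hw hx).mem_iff _).1 (mem_span_pair_right _ _)

/-- If `neutral`, `x`, `x * x` are not collinear, then multiplication by `x` is linear. -/
theorem twist_eq_id_of_notMem {x : V} (hF : ∃ t : F, t ≠ 0 ∧ t ≠ 1)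
    (hx : x ∉ span F {M.neutral}) (hxx : M.mul x x ∉ span F {M.neutral, x}) :
    M.twist x = RingHom.id F := by
  have hx0 := M.ne_zero_of_notMem hx
  have hi := indep₃_of_notMem (M.indep₂_neutral hx) hxx
  have h0 := M.ne_zero_of_notMem (M.neutral_add_notMem hx)
  obtain ⟨f, g, -, -, hfg⟩ := M.exists_mul_neutral_add_eq hx hx0
  set σ := M.twist x with hσ
  set τ := M.twist (M.neutral + x) with hτ
  -- Two expansions of `(neutral + x) * (neutral + t • x)` are compared in the independent vectors
  -- `neutral`, `x`, `x * x`.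
  have key : ∀ t : F, t ≠ 0 → (t + g * (τ t / σ t) = 1 + τ t * f) := by
    intro t ht
    have hσt : σ t ≠ 0 := (_root_.map_ne_zero _).2 ht
    have hne : M.neutral + t • x ≠ 0 := fun h => one_ne_zero
      ((M.indep₂_neutral hx) 1 t (by rw [← h]; module)).1
    obtain ⟨p, q, -, -, hpq⟩ := M.exists_mul_neutral_add_eq hx hne
    rw [map_add, map_add, M.mul_neutral _ h0, M.mul_neutral _ hx0, map_smulₛₗ, map_smulₛₗ, hfg] at hpq
    obtain ⟨h₁, h₂, h₃⟩ := hi (1 - p) (1 + τ t * f - p * t - q) (τ t * g - q * σ t) (by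
      rw [← sub_eq_zero.2 hpq, hσ, hτ]; module)
    field_simp
    linear_combination (t * σ t) * h₁ - σ t * h₂ + h₃
  have hfg1 : f = g := by
    have := key 1 one_ne_zero
    simp only [map_one, div_one, mul_one, one_mul] at this
    linear_combination -this
  subst hfg1
  let ι : Fˣ →* F := Units.coeHom F
  have hcomp : ∀ ρ : F →+* F, (ρ : F →* F).comp ι ≠ 1 := by
    obtain ⟨t, ht, ht1⟩ := hF
    intro ρ h
    have := DFunLike.congr_fun h (Units.mk0 t ht)
    exact ht1 (ρ.injective (by simpa [ι] using this))
  let χ : Fˣ →* F :=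
    { toFun := fun t => τ t / σ t
      map_one' := by simp
      map_mul' := fun s t => by simp [mul_div_mul_comm] }
  have hlin := linearIndependent_monoidHom Fˣ F
  -- `key` reads `1 = ι + f χ - f τ` as a relation between characters of `Fˣ`. Since `ι` and `τ` are
  -- nontrivial, Dedekind's theorem leaves only `χ = 1`, that is `τ = σ`.
  have hχ : χ = 1 := by
    by_contra hne
    refine hlin.notMem_span_image (s := {ι, χ, (τ : F →* F).comp ι}) (x := 1) ?_ ?_
    · rintro (h | h | h)
      · exact hcomp (RingHom.id F) h.symm
      · exact hne h.symm
      · exact hcomp τ h.symm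
    · have : ((1 : Fˣ →* F) : Fˣ → F) = (ι : Fˣ → F) + f • (χ : Fˣ → F) -
          f • (((τ : F →* F).comp ι : Fˣ →* F) : Fˣ → F) := by
        funext t
        have := key t t.ne_zero
        simp only [MonoidHom.one_apply, Pi.sub_apply, Pi.add_apply, Pi.smul_apply, smul_eq_mul]
        change 1 = (t : F) + f * (τ t / σ t) - f * τ t
        linear_combination -this
      rw [this]
      refine sub_mem (add_mem ?_ (smul_mem _ _ ?_)) (smul_mem _ _ ?_) <;>
        exact subset_span (Set.mem_image_of_mem _ (by simp))
  have hτσ : ∀ t : F, τ t = σ t := by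
    intro t
    by_cases ht : t = 0
    · simp [ht]
    · have : τ t / σ t = 1 := DFunLike.congr_fun hχ (Units.mk0 t ht)
      exact (div_eq_one_iff_eq ((_root_.map_ne_zero _).2 ht)).1 this
  -- With `χ = 1` the relation becomes `ι = (1 - f) + f τ`, and independence now forces `τ = ι`.
  have hι : (τ : F →* F).comp ι = ι := by
    by_contra hne
    refine hlin.notMem_span_image (s := {1, (τ : F →* F).comp ι}) (x := ι) ?_ ?_
    · rintro (h | h)
      · exact hcomp (RingHom.id F) h
      · exact hne h.symm
    · have : (ι : Fˣ → F) = (1 - f) • ((1 : Fˣ →* F) : Fˣ → F) +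
          f • (((τ : F →* F).comp ι : Fˣ →* F) : Fˣ → F) := by
        funext t
        have := key t t.ne_zero
        rw [hτσ, div_self ((_root_.map_ne_zero _).2 t.ne_zero), ← hτσ] at this
        simp only [MonoidHom.one_apply, Pi.add_apply, Pi.smul_apply, smul_eq_mul]
        change (t : F) = (1 - f) * 1 + f * τ t
        linear_combination this
      rw [this]
      refine add_mem (smul_mem _ _ ?_) (smul_mem _ _ ?_) <;>
        exact subset_span (Set.mem_image_of_mem _ (by simp))
  ext t
  by_cases ht : t = 0
  · simp [ht]
  · rw [← hτσ]
    exact DFunLike.congr_fun hι (Units.mk0 t ht)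

/-- Multiplication by `x` as a linear map, if its twist is trivial. -/
def linearMul (x : V) (hx : M.twist x = RingHom.id F) : V →ₗ[F] V where
  toFun := M.mul x
  map_add' := map_add _
  map_smul' := fun c v => (map_smulₛₗ (M.mul x) c v).trans
    (congrArg (fun ρ : F →+* F => ρ c • M.mul x v) hx)

theorem mul_self_mem_span [FiniteDimensional F V]
    (hdeg : ∀ p : F[X], Irreducible p → p.natDegree ≤ 2) (hF : ∃ t : F, t ≠ 0 ∧ t ≠ 1) {x : V}
    (hx : x ∉ span F {M.neutral}) : M.mul x x ∈ span F {M.neutral, x} := by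
  by_contra hxx
  have : Nontrivial V := ⟨⟨M.neutral, 0, M.neutral_ne_zero⟩⟩
  obtain ⟨w, hw, h⟩ := exists_apply_apply_mem_span hdeg
    (M.linearMul x (M.twist_eq_id_of_notMem hF hx hxx))
  exact hxx (M.mul_mul_self_mem_span (M.ne_zero_of_notMem hx) hw h)

theorem mul_mem_line
    (hself : ∀ x, x ∉ span F {M.neutral} → M.mul x x ∈ span F {M.neutral, x})
    {x p q : V} (hp0 : p ≠ 0) (hq0 : q ≠ 0)
    (hp : p ∈ span F {M.neutral, x}) (hq : q ∈ span F {M.neutral, x}) :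
    M.mul p q ∈ span F {M.neutral, x} := by
  by_cases hp1 : p ∈ span F {M.neutral}
  · obtain ⟨k, rfl⟩ := mem_span_singleton.1 hp1
    rw [(M.comm _ q hp0 hq0).mem_iff, map_smulₛₗ, M.mul_neutral q hq0]
    exact smul_mem _ _ hq
  · have hxp : x ∈ span F {M.neutral, p} := by
      obtain ⟨a, b, rfl⟩ := mem_span_pair.1 hp
      have hb : b ≠ 0 := by
        rintro rfl
        exact hp1 (mem_span_singleton.2 ⟨a, by simp⟩)
      refine (smul_mem_iff _ hb).1 (mem_span_pair.2 ⟨-a, 1, by module⟩)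
    have hq' : q ∈ span F {M.neutral, p} := span_pair_le (mem_span_pair_left _ _) hxp hq
    rw [M.mul_mem_span_iff p _ _ _ hp0, M.mul_neutral p hp0] at hq'
    refine span_pair_le hp ?_ hq'
    exact span_pair_le (mem_span_pair_left _ _) hp (hself p hp1)

/-- Since `c * c` is on the line through `neutral` and `c`, multiplying by `b` puts `b * (c * c)`,
which is the point `c`, on the line through `b` and `neutral`. -/
theorem inv_mem_line
    (hself : ∀ x, x ∉ span F {M.neutral} → M.mul x x ∈ span F {M.neutral, x})
    {x b c : V} (hb0 : b ≠ 0) (hc0 : c ≠ 0) (hb : b ∈ span F {M.neutral, x})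
    (hbc : Proportional F (M.mul b c) M.neutral) : c ∈ span F {M.neutral, x} := by
  by_cases hc1 : c ∈ span F {M.neutral}
  · exact span_mono (by simp) hc1
  have h := (M.mul_mem_span_iff b _ _ _ hb0).1 (hself c hc1)
  rw [M.mul_neutral b hb0] at h
  have hbc0 := M.mul_apply_ne_zero b c hb0 hc0
  have h' : Proportional F (M.mul b (M.mul c c)) c :=
    ((M.assoc b c c hb0 hc0 hc0).trans
      (M.mul_congr_left hc0 hbc0 M.neutral_ne_zero hbc)).trans (M.neutral_mul hc0)
  rw [h'.mem_iff] at h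
  exact span_pair_le hb ((hbc.mem_iff _).2 (mem_span_pair_left _ _)) h

/-- The line through `y` and `x * y` is the coset by `y` of the subgroup formed by the line through
`neutral` and `x`; a common point would put `y` in the subgroup. -/
theorem line_disjoint
    (hself : ∀ x, x ∉ span F {M.neutral} → M.mul x x ∈ span F {M.neutral, x})
    {x y p : V} (hx : x ≠ 0) (hy0 : y ≠ 0) (hy : y ∉ span F {M.neutral, x})
    (hp : p ∈ span F {y, M.mul x y}) (hp' : p ∈ span F {M.neutral, x}) : p = 0 := by
  by_contra hp0
  obtain ⟨b, hb0, hbp⟩ := M.exists_mul y p hy0 hp0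
  have hb : b ∈ span F {M.neutral, x} := by
    rw [M.mul_mem_span_iff y _ _ _ hy0, M.mul_neutral y hy0, hbp.mem_iff]
    refine span_pair_le (mem_span_pair_left _ _) ?_ hp
    exact ((M.comm x y hx hy0).mem_iff _).2 (mem_span_pair_right _ _)
  obtain ⟨c, hc0, hbc⟩ := M.exists_mul b M.neutral hb0 M.neutral_ne_zero
  have hc := M.inv_mem_line hself hb0 hc0 hb hbc
  have hcp := M.mul_mem_line hself hc0 hp0 hc hp'
  have hbc0 := M.mul_apply_ne_zero b c hb0 hc0
  have hcb0 := M.mul_apply_ne_zero c b hc0 hb0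
  have h : Proportional F (M.mul c p) y := by
    refine (M.mul_congr_right (hbp.symm.trans (M.comm y b hy0 hb0))).trans ?_
    refine (M.assoc c b y hc0 hb0 hy0).trans ?_
    exact (M.mul_congr_left hy0 hcb0 M.neutral_ne_zero
      ((M.comm c b hc0 hb0).trans hbc)).trans (M.neutral_mul hy0)
  exact hy ((h.mem_iff _).1 hcp)

/-- For `y` off the line, disjointness of cosets makes `neutral`, `x`, `y`, `x * y` independent.
Comparing two expansions of `(neutral + x) * (neutral + t • y)` gives `f = g = 1` and trivial
twists. -/
theorem linear_of_line
    (hself : ∀ x, x ∉ span F {M.neutral} → M.mul x x ∈ span F {M.neutral, x})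
    (hdim : ∀ u v : V, ∃ w, w ∉ span F {u, v}) {x : V}
    (hx : x ∉ span F {M.neutral}) :
    M.twist x = RingHom.id F ∧ ∀ y, M.mul (M.neutral + x) y = y + M.mul x y := by
  have hx0 := M.ne_zero_of_notMem hx
  have h0 := M.ne_zero_of_notMem (M.neutral_add_notMem hx)
  have key : ∀ y, y ∉ span F {M.neutral, x} →
      M.twist x = RingHom.id F ∧ M.mul (M.neutral + x) y = y + M.mul x y := by
    intro y hy
    have hy0 : y ≠ 0 := fun h => hy (by rw [h]; exact zero_mem _)
    have hi : ∀ a b c d : F, a • M.neutral + b • x + c • y + d • M.mul x y = 0 →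
        a = 0 ∧ b = 0 ∧ c = 0 ∧ d = 0 := by
      intro a b c d h
      have h₁ : c • y + d • M.mul x y = (-a) • M.neutral + (-b) • x := by
        rw [← sub_eq_zero, ← h]; module
      have h₂ := M.line_disjoint hself hx0 hy0 hy (mem_span_pair.2 ⟨c, d, h₁⟩)
        (mem_span_pair.2 ⟨_, _, rfl⟩)
      obtain ⟨ha, hb⟩ := M.indep₂_neutral hx _ _ h₂
      obtain ⟨hc, hd⟩ := M.indep₂_mul hx hy0 c d (h₁.trans h₂)
      exact ⟨neg_eq_zero.1 ha, neg_eq_zero.1 hb, hc, hd⟩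
    obtain ⟨f, g, -, -, hfg⟩ := M.exists_mul_neutral_add_eq hx hy0
    have coeff : ∀ t : F, t = M.twist (M.neutral + x) t * f ∧
        M.twist x t = M.twist (M.neutral + x) t * g := by
      intro t
      have hne : M.neutral + t • y ≠ 0 := fun h => one_ne_zero
        (hi 1 0 t 0 (by rw [← h]; module)).1
      obtain ⟨p, q, -, -, hpq⟩ := M.exists_mul_neutral_add_eq hx hne
      rw [map_add, map_add, M.mul_neutral _ h0, M.mul_neutral _ hx0, map_smulₛₗ, map_smulₛₗ, hfg] at hpq
      obtain ⟨h₁, h₂, h₃, h₄⟩ := hi (1 - p) (1 - q) (M.twist (M.neutral + x) t * f - p * t)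
        (M.twist (M.neutral + x) t * g - q * M.twist x t) (by
          rw [← sub_eq_zero.2 hpq]; module)
      exact ⟨by linear_combination t * h₁ - h₃,
        by linear_combination M.twist x t * h₂ - h₄⟩
    have hone := coeff 1
    simp only [map_one, one_mul] at hone
    obtain ⟨rfl, rfl⟩ := hone
    refine ⟨?_, by simpa using hfg⟩
    ext t
    obtain ⟨h₁, h₂⟩ := coeff t
    rw [h₂, ← h₁, RingHom.id_apply]
  obtain ⟨z, hz⟩ := hdim M.neutral x
  refine ⟨(key z hz).1, fun y => ?_⟩
  by_cases hy : y ∈ span F {M.neutral, x}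
  · have hyz : y + z ∉ span F {M.neutral, x} := fun h => hz (by simpa using sub_mem h hy)
    have h := (key _ hyz).2
    rw [map_add, map_add, (key z hz).2] at h
    refine add_right_cancel (b := z + M.mul x z) (h.trans ?_)
    abel
  · exact (key y hy).2

/-- Comparing `(neutral + x) * y = y + x * y` with a multiple of `y * (neutral + x) = y + y * x`
forces the commutation factor to be one. -/
theorem mul_comm_of_add
    (hadd : ∀ x, x ∉ span F {M.neutral} → ∀ y, M.mul (M.neutral + x) y = y + M.mul x y)
    {x y : V} (hx : x ∉ span F {M.neutral}) (hy : y ≠ 0) : M.mul x y = M.mul y x := by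
  have hx0 := M.ne_zero_of_notMem hx
  obtain ⟨k, -, hk⟩ := M.comm y x hy hx0
  obtain ⟨l, -, hl⟩ := M.comm (M.neutral + x) y
    (M.ne_zero_of_notMem (M.neutral_add_notMem hx)) hy
  rw [hadd x hx, map_add, M.mul_neutral y hy, hk] at hl
  obtain ⟨h₁, h₂⟩ := M.indep₂_mul hx hy (1 - l) (1 - l * k) (by
    rw [← sub_eq_zero.2 hl]; module)
  rw [hk, show k = 1 by linear_combination -h₂ + k * h₁, one_smul]

theorem mul_smul_of_twist {x : V} (hx : M.twist x = RingHom.id F) (c : F) (v : V) :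
    M.mul x (c • v) = c • M.mul x v :=
  (M.linearMul x hx).map_smul c v

/-- Completing the square: outside a given plane there is a vector with scalar square. -/
theorem exists_mul_self_eq_smul [NeZero (2 : F)]
    (hself : ∀ x, x ∉ span F {M.neutral} → M.mul x x ∈ span F {M.neutral, x})
    (htwist : ∀ x, x ∉ span F {M.neutral} → M.twist x = RingHom.id F)
    (hcomm : ∀ x y, x ∉ span F {M.neutral} → y ≠ 0 → M.mul x y = M.mul y x)
    {W : Submodule F V} (hW : M.neutral ∈ W) (hne : ∃ x, x ∉ W) :
    ∃ a, a ∉ W ∧ ∃ δ : F, ¬ IsSquare δ ∧ M.mul a a = δ • M.neutral := by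
  obtain ⟨x, hx⟩ := hne
  have hle : span F {M.neutral} ≤ W := span_le.2 (Set.singleton_subset_iff.2 hW)
  have hx1 : x ∉ span F {M.neutral} := fun h => hx (hle h)
  have hx0 := M.ne_zero_of_notMem hx1
  obtain ⟨β, α, hαβ⟩ := mem_span_pair.1 (hself x hx1)
  have h2 : (2 : F) ≠ 0 := NeZero.ne _
  obtain ⟨s, rfl⟩ : ∃ s, α = 2 * s := ⟨α / 2, by field_simp⟩
  set a := x - s • M.neutral with ha
  have haW : a ∉ W := fun h => hx (by simpa [ha] using add_mem h (W.smul_mem s hW))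
  have ha1 : a ∉ span F {M.neutral} := fun h => haW (hle h)
  have ha0 := M.ne_zero_of_notMem ha1
  have hmul : M.mul a a = (β + s ^ 2) • M.neutral := by
    conv_lhs => rw [ha]
    rw [map_sub, M.mul_smul_of_twist (htwist _ ha1), M.mul_neutral _ ha0,
      hcomm _ x ha1 hx0, ha, map_sub, M.mul_smul_of_twist (htwist x hx1), M.mul_neutral x hx0,
      ← hαβ]
    module
  refine ⟨a, haW, _, ?_, hmul⟩
  rintro ⟨t, ht⟩
  -- If `δ = t ^ 2`, then `a + t • neutral` is an eigenvector of `mul a` with eigenvalue `t`.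
  refine ha1 (M.mem_span_neutral_of_mul_eq (y := a + t • M.neutral) (k := t) ?_ ?_)
  · intro h
    exact ha1 (mem_span_singleton.2 ⟨-t, by rw [← sub_eq_zero, ← neg_eq_zero, ← h]; module⟩)
  · rw [map_add, M.mul_smul_of_twist (htwist a ha1), M.mul_neutral a ha0, hmul, ht]
    module

theorem false_of_isAlgClosed_or_isRealClosed (M : Multiplication F V) [FiniteDimensional F V]
    (hF : IsAlgClosed F ∨ IsRealClosed F) (hdim : ∀ u v : V, ∃ w, w ∉ span F {u, v}) :
    False := by
  have hdeg : ∀ p : F[X], Irreducible p → p.natDegree ≤ 2 := by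
    rcases hF with hF | hF
    · intro p hp
      rw [natDegree_eq_of_degree_eq_some (IsAlgClosed.degree_eq_one_of_irreducible F hp)]
      exact one_le_two
    · intro p hp
      exact natDegree_le_two_of_irreducible hp
  have ht : ∃ t : F, t ≠ 0 ∧ t ≠ 1 := by
    have : Infinite F := by
      rcases hF with hF | hF <;> infer_instance
    obtain ⟨t, ht⟩ := (Set.toFinite ({0, 1} : Set F)).exists_notMem
    exact ⟨t, by simpa [not_or] using ht⟩
  have hself := fun x (hx : x ∉ span F {M.neutral}) => M.mul_self_mem_span hdeg ht hx
  have htwist := fun x (hx : x ∉ span F {M.neutral}) => (M.linear_of_line hself hdim hx).1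
  have hcomm := fun x y (hx : x ∉ span F {M.neutral}) (hy : y ≠ 0) => M.mul_comm_of_add
    (fun x hx => (M.linear_of_line hself hdim hx).2) hx hy
  obtain ⟨x, hx⟩ := hdim M.neutral M.neutral
  have hx1 := hx
  rw [Set.pair_eq_singleton] at hx1
  rcases hF with hF | hF
  · have : Nontrivial V := ⟨⟨M.neutral, 0, M.neutral_ne_zero⟩⟩
    obtain ⟨c, hc⟩ := Module.End.exists_eigenvalue (M.linearMul x (htwist x hx1))
    obtain ⟨v, hv⟩ := hc.exists_hasEigenvector
    exact hx1 (M.mem_span_neutral_of_mul_eq hv.2 hv.apply_eq_smul)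
  · obtain ⟨a, ha, δ, hδ, haa⟩ := M.exists_mul_self_eq_smul hself htwist hcomm
      (mem_span_singleton_self M.neutral) ⟨x, hx1⟩
    obtain ⟨b, hb, ε, hε, hbb⟩ := M.exists_mul_self_eq_smul hself htwist hcomm
      (mem_span_pair_left M.neutral a) (hdim M.neutral a)
    have hb1 : b ∉ span F {M.neutral} := fun h => hb (span_mono (by simp) h)
    have ha0 := M.ne_zero_of_notMem ha
    have hb0 := M.ne_zero_of_notMem hb1
    obtain ⟨r, hr⟩ := IsRealClosed.isSquare_neg_of_not_isSquare hδ
    obtain ⟨s, hs⟩ := IsRealClosed.isSquare_neg_of_not_isSquare hε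
    have hr0 : r ≠ 0 := by
      rintro rfl
      exact hδ ⟨0, by linear_combination -hr⟩
    have hs0 : s ≠ 0 := by
      rintro rfl
      exact hε ⟨0, by linear_combination -hs⟩
    have hv : s • a + r • b ≠ 0 := fun h => hb ((smul_mem_iff _ hr0).1
      (mem_span_pair.2 ⟨0, -s, by rw [← sub_eq_zero, ← neg_eq_zero, ← h]; module⟩))
    -- This is `(s a - r b) (s a + r b) = 0`: both `s a` and `r b` have square `-(r s) ^ 2 •
    -- neutral`.
    have hprop : s • M.mul a (s • a + r • b) = r • M.mul b (s • a + r • b) := by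
      simp only [map_add, M.mul_smul_of_twist (htwist a ha), M.mul_smul_of_twist (htwist b hb1),
        haa, hbb, hcomm b a hb1 ha0]
      have h : s ^ 2 * δ = r ^ 2 * ε := by linear_combination r ^ 2 * hs - s ^ 2 * hr
      have h' := congrArg (fun c : F => c • M.neutral) h
      rw [← sub_eq_zero] at h' ⊢
      rw [← h']
      module
    obtain ⟨k, -, hk⟩ := M.right_cancel hv hb0 ha0
      ((Proportional.smul_left hr0 _).symm.trans (hprop ▸ Proportional.smul_left hs0 _))
    exact hb (mem_span_pair.2 ⟨0, k, by rw [hk]; module⟩)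

end Multiplication

end IncidenceGroup

namespace IncidenceGroup

open Submodule

/-! ### From collineations to a multiplication on vectors -/

section Extraction

variable {F V : Type*} [Field F] [AddCommGroup V] [Module F V]

theorem proportional_iff_mk_eq {x y : V} (hx : x ≠ 0) (hy : y ≠ 0) :
    Proportional F x y ↔ Projectivization.mk F x hx = Projectivization.mk F y hy := by
  rw [Projectivization.mk_eq_mk_iff']
  exact ⟨fun ⟨k, _, h⟩ => ⟨k, h.symm⟩, fun ⟨k, h⟩ => Proportional.of_eq_smul hx h.symm⟩

theorem proportional_rep_mk {x : V} (hx : x ≠ 0) :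
    Proportional F (Projectivization.mk F x hx).rep x := by
  rw [proportional_iff_mk_eq (Projectivization.rep_nonzero _) hx, Projectivization.mk_rep]

theorem proportional_rep_iff {p q : Projectivization F V} :
    Proportional F p.rep q.rep ↔ p = q := by
  rw [proportional_iff_mk_eq p.rep_nonzero q.rep_nonzero, Projectivization.mk_rep,
    Projectivization.mk_rep]

theorem rep_mem_span_singleton_iff {p q : Projectivization F V} :
    p.rep ∈ span F {q.rep} ↔ p = q := by
  rw [← proportional_rep_iff, mem_span_singleton]
  exact ⟨fun ⟨k, h⟩ => Proportional.of_eq_smul p.rep_nonzero h.symm,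
    fun ⟨k, _, h⟩ => ⟨k, h.symm⟩⟩

theorem mem_line_iff {x y z : Projectivization F V} :
    z ∈ line x y ↔ z.rep ∈ span F {x.rep, y.rep} := by
  constructor
  · rintro (⟨a, b, -, -, h⟩ | rfl | rfl)
    · exact mem_span_pair.2 ⟨a, b, h.symm⟩
    · exact mem_span_pair_left _ _
    · exact mem_span_pair_right _ _
  · intro h
    obtain ⟨a, b, hab⟩ := mem_span_pair.1 h
    by_cases ha : a = 0
    · refine Or.inr (Or.inr (rep_mem_span_singleton_iff.1 (mem_span_singleton.2 ⟨b, ?_⟩)))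
      rw [← hab, ha, zero_smul, zero_add]
    by_cases hb : b = 0
    · refine Or.inr (Or.inl (rep_mem_span_singleton_iff.1 (mem_span_singleton.2 ⟨a, ?_⟩)))
      rw [← hab, hb, zero_smul, add_zero]
    · exact Or.inl ⟨a, b, ha, hb, hab.symm⟩

theorem line_eq_of_mem {x y z : Projectivization F V} (hz : z ∈ line x y) (hzx : z ≠ x) :
    line x z = line x y := by
  rw [mem_line_iff] at hz
  have hy : y.rep ∈ span F {x.rep, z.rep} := by
    obtain ⟨a, b, hab⟩ := mem_span_pair.1 hz
    have hb : b ≠ 0 := by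
      rintro rfl
      exact hzx (rep_mem_span_singleton_iff.1
        (mem_span_singleton.2 ⟨a, by rw [← hab, zero_smul, add_zero]⟩))
    refine (smul_mem_iff _ hb).1 (mem_span_pair.2 ⟨-a, 1, ?_⟩)
    rw [← hab]; module
  ext w
  rw [mem_line_iff, mem_line_iff]
  exact ⟨fun h => span_pair_le (mem_span_pair_left _ _) hz h,
    fun h => span_pair_le (mem_span_pair_left _ _) hy h⟩

namespace IsCollineation

variable {α : Projectivization F V → Projectivization F V} {β : lines F V → lines F V}

theorem mem_line_iff (h : IsCollineation α β) {x y z : Projectivization F V} (hxy : x ≠ y) :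
    z ∈ line x y ↔ α z ∈ line (α x) (α y) := by
  by_cases hzx : z = x
  · subst hzx
    exact iff_of_true (Or.inr (Or.inl rfl)) (Or.inr (Or.inl rfl))
  have hα : α z ≠ α x := fun h' => hzx (h.bijective_points.injective h')
  have h₁ := h.map_line x z (Ne.symm hzx)
  have h₂ := h.map_line x y hxy
  constructor
  · intro hz
    have heq := line_eq_of_mem hz hzx
    have : line (α x) (α z) = line (α x) (α y) := by
      rw [← h₁, ← h₂]
      congr 2
      exact Subtype.ext heq
    rw [← this]
    exact Or.inr (Or.inr rfl)
  · intro hz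
    -- Reflecting collinearity uses injectivity of the map on lines: equal image lines come from
    -- equal lines.
    have heq := line_eq_of_mem hz hα
    rw [← h₁, ← h₂] at heq
    have := congrArg Subtype.val (h.bijective_lines.injective (Subtype.ext heq))
    rw [← show line x z = line x y from this]
    exact Or.inr (Or.inr rfl)

theorem rep_mem_span_iff (h : IsCollineation α β) (x y z : Projectivization F V) :
    z.rep ∈ span F {x.rep, y.rep} ↔ (α z).rep ∈ span F {(α x).rep, (α y).rep} := by
  by_cases hxy : x = y
  · subst hxy
    rw [Set.pair_eq_singleton, Set.pair_eq_singleton, rep_mem_span_singleton_iff,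
      rep_mem_span_singleton_iff]
    exact h.bijective_points.injective.eq_iff.symm
  · rw [← IncidenceGroup.mem_line_iff, ← IncidenceGroup.mem_line_iff]
    exact h.mem_line_iff hxy

end IsCollineation

open Classical in
/-- The map of representatives induced by a map of projective points. -/
noncomputable def vectorMap (α : Projectivization F V → Projectivization F V) (v : V) : V :=
  if h : v = 0 then 0 else (α (Projectivization.mk F v h)).rep

theorem vectorMap_zero (α : Projectivization F V → Projectivization F V) :
    vectorMap α 0 = 0 := dif_pos rfl

theorem vectorMap_of_ne_zero (α : Projectivization F V → Projectivization F V) {v : V}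
    (hv : v ≠ 0) : vectorMap α v = (α (Projectivization.mk F v hv)).rep := dif_neg hv

theorem IsCollineation.isProjective {α : Projectivization F V → Projectivization F V}
    {β : lines F V → lines F V} (h : IsCollineation α β) :
    IsProjective (F := F) (vectorMap α) := by
  have hpair : ∀ u v w : V, u ≠ 0 → v ≠ 0 →
      (w ∈ span F {u, v} ↔ vectorMap α w ∈ span F {vectorMap α u, vectorMap α v}) := by
    intro u v w hu hv
    by_cases hw : w = 0
    · rw [hw, vectorMap_zero]
      exact iff_of_true (zero_mem _) (zero_mem _)
    rw [vectorMap_of_ne_zero α hu, vectorMap_of_ne_zero α hv, vectorMap_of_ne_zero α hw,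
      ← h.rep_mem_span_iff, (proportional_rep_mk hw).mem_iff]
    have : span F {(Projectivization.mk F u hu).rep, (Projectivization.mk F v hv).rep} =
        span F {u, v} :=
      le_antisymm
        (span_pair_le (((proportional_rep_mk hu).mem_iff _).2 (mem_span_pair_left _ _))
          (((proportional_rep_mk hv).mem_iff _).2 (mem_span_pair_right _ _)))
        (span_pair_le (((proportional_rep_mk hu).mem_iff _).1 (mem_span_pair_left _ _))
          (((proportional_rep_mk hv).mem_iff _).1 (mem_span_pair_right _ _)))
    rw [this]
  have hzero : ∀ v : V, vectorMap α v = 0 ↔ v = 0 := fun v =>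
    ⟨fun hv => by
      by_contra hv0
      rw [vectorMap_of_ne_zero α hv0] at hv
      exact Projectivization.rep_nonzero _ hv, fun hv => hv ▸ vectorMap_zero α⟩
  refine ⟨hzero, fun u v w => ?_⟩
  by_cases hu : u = 0
  · subst hu
    rw [vectorMap_zero, span_insert_zero, span_insert_zero]
    by_cases hv : v = 0
    · subst hv
      rw [vectorMap_zero, span_zero_singleton, mem_bot, mem_bot, hzero]
    · simpa only [Set.pair_eq_singleton] using hpair v v w hv hv
  by_cases hv : v = 0
  · subst hv
    rw [vectorMap_zero, Set.pair_comm, Set.pair_comm _ (0 : V), span_insert_zero,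
      span_insert_zero]
    simpa only [Set.pair_eq_singleton] using hpair u u w hu hu
  · exact hpair u v w hu hv

theorem exists_semilinear_translation [CommGroup (Projectivization F V)]
    (hcol : ∀ a : Projectivization F V, ∃ β : lines F V → lines F V,
      IsCollineation (fun x => a * x) β)
    (hdim : ∀ u v : V, ∃ w, w ∉ span F {u, v}) {x : V} (hx : x ≠ 0) :
    ∃ (σ : F →+* F) (φ : V →ₛₗ[σ] V), φ (1 : Projectivization F V).rep = x ∧
      (∀ v (hv : v ≠ 0), ∃ h : φ v ≠ 0, Projectivization.mk F (φ v) h =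
        Projectivization.mk F x hx * Projectivization.mk F v hv) ∧
      ∀ u v w, w ∈ span F {u, v} ↔ φ w ∈ span F {φ u, φ v} := by
  obtain ⟨β, hβ⟩ := hcol (Projectivization.mk F x hx)
  have hL := hβ.isProjective
  obtain ⟨σ, φ, hφ⟩ := hL.exists_semilinear hdim
  have hmk : ∀ v (hv : v ≠ 0), Proportional F (φ v)
      (Projectivization.mk F x hx * Projectivization.mk F v hv).rep := fun v hv => by
    simpa only [vectorMap_of_ne_zero _ hv] using hφ v
  -- The semilinear map is determined only up to a scalar; `k` normalises it to send the neutral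
  -- representative to `x` itself.
  obtain ⟨k, hk, hkx⟩ : Proportional F x (φ (1 : Projectivization F V).rep) := by
    refine (proportional_rep_mk hx).symm.trans ?_
    have := hmk _ (1 : Projectivization F V).rep_nonzero
    rw [Projectivization.mk_rep, mul_one] at this
    exact this.symm
  have hkφ : ∀ v, Proportional F ((k • φ) v) (φ v) := fun v => Proportional.smul_left hk _
  refine ⟨σ, k • φ, hkx.symm, fun v hv => ?_, fun u v w => ?_⟩
  · have h0 := (hkφ v).trans (hmk v hv)
    have hne : (k • φ) v ≠ 0 := fun h => Projectivization.rep_nonzero _ (h0.eq_zero_iff.1 h)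
    refine ⟨hne, ?_⟩
    rw [proportional_iff_mk_eq hne (Projectivization.rep_nonzero _)] at h0
    rw [h0, Projectivization.mk_rep]
  · exact hL.mem_span_iff_of_proportional ((hkφ u).trans (hφ u)) ((hkφ v).trans (hφ v))
      ((hkφ w).trans (hφ w))

theorem nonempty_multiplication (h : AdmitsIncidenceAbelianGroup F V)
    (hdim : ∀ u v : V, ∃ w, w ∉ span F {u, v}) : Nonempty (Multiplication F V) := by
  obtain ⟨_, hcol⟩ := h
  have key : ∀ x : V, ∃ (σ : F →+* F) (φ : V →ₛₗ[σ] V), ∀ hx : x ≠ 0,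
      φ (1 : Projectivization F V).rep = x ∧
      (∀ v (hv : v ≠ 0), ∃ h : φ v ≠ 0, Projectivization.mk F (φ v) h =
        Projectivization.mk F x hx * Projectivization.mk F v hv) ∧
      ∀ u v w, w ∈ span F {u, v} ↔ φ w ∈ span F {φ u, φ v} := by
    intro x
    by_cases hx : x = 0
    -- The zero vector represents no point, so its map is an arbitrary default.
    · exact ⟨RingHom.id F, 0, fun h => absurd hx h⟩
    · obtain ⟨σ, φ, h⟩ := exists_semilinear_translation hcol hdim hx
      exact ⟨σ, φ, fun _ => h⟩
  choose σ φ hφ using key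
  have hne : ∀ x y, x ≠ 0 → y ≠ 0 → φ x y ≠ 0 := fun x y hx hy => ((hφ x hx).2.1 y hy).1
  have hmk : ∀ x y (hx : x ≠ 0) (hy : y ≠ 0), Projectivization.mk F (φ x y) (hne x y hx hy) =
      Projectivization.mk F x hx * Projectivization.mk F y hy :=
    fun x y hx hy => ((hφ x hx).2.1 y hy).2
  exact ⟨{
    neutral := (1 : Projectivization F V).rep
    neutral_ne_zero := Projectivization.rep_nonzero _
    twist := σ
    mul := φ
    mul_neutral := fun x hx => (hφ x hx).1
    mul_apply_ne_zero := hne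
    comm := fun x y hx hy => by
      rw [proportional_iff_mk_eq (hne x y hx hy) (hne y x hy hx), hmk x y hx hy,
        hmk y x hy hx, mul_comm]
    assoc := fun x y z hx hy hz => by
      rw [proportional_iff_mk_eq (hne _ _ hx (hne y z hy hz)) (hne _ _ (hne x y hx hy) hz),
        hmk x _ hx (hne y z hy hz), hmk y z hy hz, hmk _ z (hne x y hx hy) hz, hmk x y hx hy,
        mul_assoc]
    exists_mul := fun x y hx hy => by
      have h0 := Projectivization.rep_nonzero
        ((Projectivization.mk F x hx)⁻¹ * Projectivization.mk F y hy)
      refine ⟨_, h0, ?_⟩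
      rw [proportional_iff_mk_eq (hne _ _ hx h0) hy, hmk x _ hx h0, Projectivization.mk_rep,
        mul_inv_cancel_left]
    left_cancel := fun x y z hx hy hz h => by
      rw [proportional_iff_mk_eq (hne x y hx hy) (hne x z hx hz), hmk x y hx hy, hmk x z hx hz,
        mul_right_inj] at h
      exact (proportional_iff_mk_eq hy hz).2 h
    mul_mem_span_iff := fun x u v w hx => (hφ x hx).2.2 u v w }⟩

end Extraction

end IncidenceGroup

theorem mainTheorem5 {F : Type*} [Field F] (hF : IsAlgClosed F ∨ IsRealClosed F)
    (n : ℕ) (hn : 1 < n) :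
    ¬ IncidenceGroup.AdmitsIncidenceAbelianGroup F (Fin (n + 1) → F) := by
  intro h
  have hdim : ∀ u v : Fin (n + 1) → F, ∃ w, w ∉ Submodule.span F {u, v} := by
    classical
    intro u v
    by_contra! hw
    have htop : Submodule.span F {u, v} = ⊤ := Submodule.eq_top_iff'.2 hw
    have hle := finrank_span_finset_le_card (R := F) ({u, v} : Finset (Fin (n + 1) → F))
    rw [Set.finrank, Finset.coe_pair, htop, finrank_top, Module.finrank_fin_fun] at hle
    have := Finset.card_le_two (a := u) (b := v)
    omega
  obtain ⟨M⟩ := IncidenceGroup.nonempty_multiplication h hdim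
  exact M.false_of_isAlgClosed_or_isRealClosed hF hdim
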